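/- For $\epsilon,\epsilon'\in\mathbb R$, $\zeta\in\mathbb C$ and $\tau\in\mathbb C$ with $\operatorname{Im}\tau>0$ let $$\theta\begin{bmatrix}\epsilon\\ \epsilon'\end{bmatrix}(\zeta,\tau)=\sum_{n\in\mathbb Z}\exp\left(2\pi i\left[\tfrac12\left(n+\tfrac{\epsilon}{2}\right)^2\tau+\left(n+\tfrac{\epsilon}{2}\right)\left(\zeta+\tfrac{\epsilon'}{2}\right)\right]\right),$$ and for $|x|<1$ let $(x;x)_\infty=\prod_{n=1}^\infty(1-x^n)$. For $\operatorname{Im}\tau>0$ put $q=\exp(2\pi i\tau)$ and $$W=\theta^2\begin{bmatrix}1\\ \frac14\end{bmatrix}(0,\tau)\Big/\theta^2\begin{bmatrix}1\\ \frac34\end{bmatrix}(0,\tau).$$ Then the denominator does not vanish for any $\tau$ with $\operatorname{Im}\tau>0$, $W$ depends only on $q$ and is a complex differentiable function of $q$ on $0<|q|<1$, and it satisfies the Riccati equation $$q\frac{dW}{dq}=\frac{1}{(\sqrt2)^5}\,\frac{(q;q)_\infty^2\,(q^2;q^2)_\infty\,(q^4;q^4)_\infty^3}{(q^8;q^8)_\infty^2}\,\left(W^2-6W+1\right).$$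 -/

import Mathlib

/-- The theta function with real characteristics `ε`, `ε'`:
`θ[ε; ε'](ζ, τ) = ∑_{n ∈ ℤ} exp (2πi [(n + ε/2)² τ / 2 + (n + ε/2) (ζ + ε'/2)])`.
The series converges for `Im τ > 0`, see `summable_thetaChar`. -/
noncomputable def thetaChar (ε ε' : ℝ) (ζ τ : ℂ) : ℂ :=
  ∑' n : ℤ, Complex.exp (2 * Real.pi * Complex.I *
    (1 / 2 * (n + ε / 2) ^ 2 * τ + (n + ε / 2) * (ζ + ε' / 2)))

/-- The series defining `thetaChar` is absolutely convergent on the upper half plane. -/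
theorem summable_thetaChar (ε ε' : ℝ) (ζ : ℂ) {τ : ℂ} (hτ : 0 < τ.im) :
    Summable fun n : ℤ => Complex.exp (2 * Real.pi * Complex.I *
      (1 / 2 * (n + ε / 2) ^ 2 * τ + (n + ε / 2) * (ζ + ε' / 2))) := by
  have h := ((summable_jacobiTheta₂_term_iff (ζ + ε' / 2 + ε / 2 * τ) τ).2 hτ).mul_left
    (Complex.exp (2 * Real.pi * Complex.I *
      (1 / 2 * (ε / 2) ^ 2 * τ + (ε / 2) * (ζ + ε' / 2))))
  refine h.congr fun n => ?_
  rw [jacobiTheta₂_term, ← Complex.exp_add]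
  congr 1
  ring

/-- The infinite product `(x; x)_∞ = ∏_{n ≥ 1} (1 - xⁿ)`.
It converges for `‖x‖ < 1`, see `multipliable_qProd`. -/
noncomputable def qProd (x : ℂ) : ℂ := ∏' n : ℕ, (1 - x ^ (n + 1))

/-- The product defining `qProd` converges on the open unit disc. -/
theorem multipliable_qProd {x : ℂ} (hx : ‖x‖ < 1) :
    Multipliable fun n : ℕ => 1 - x ^ (n + 1) :=
  ModularForm.multipliable_one_sub_pow hx

/-- The variable `q = exp (2πiτ)`. -/
noncomputable def qVar (τ : ℂ) : ℂ := Complex.exp (2 * Real.pi * Complex.I * τ)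

/-- `W(τ) = θ²[1; 1/4](0, τ) / θ²[1; 3/4](0, τ)`. -/
noncomputable def thetaQuotW (τ : ℂ) : ℂ :=
  thetaChar 1 (1 / 4) 0 τ ^ 2 / thetaChar 1 (3 / 4) 0 τ ^ 2

/-! Write A and B for the theta series with characteristic 1/2 at z = 1/8 and z = 3/8, so that W =
A²/B². By the heat equation (`hasDerivAt_thetaSum`), q dW/dq is A/B³ times the Wronskian of A and B
formed with the series weighted by (n + 1/2)².

Passing to sums and differences of the two summation indices turns this Wronskian into products of
weight-one series at 2τ (`thetaSum_wronskian`). Since 1/8 + 3/8 = 1/2, one product vanishes, and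
Jacobi's cube identity evaluates the other as an infinite product (`thetaSum_wronskian_eighth`).

The same change of indices expresses A² - B² and AB through theta series at 2τ, which shows that A⁴
- 6A²B² + B⁴, that is B⁴(W² - 6W + 1), is also a product (`thetaSum_quartic`). The Jacobi triple
product (`tsum_eq_mul_tprod`) evaluates AB and the theta constants, and the Riccati equation becomes
a comparison of two products. It also shows B ≠ 0. -/

open Filter Topology

/-! ### Convergence and nonvanishing of q-products -/

/-- The finite product `(q; q)_n`. -/
noncomputable def qPoch (q : ℂ) (n : ℕ) : ℂ := ∏ k ∈ Finset.range n, (1 - q ^ (k + 1))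

theorem one_sub_pow_succ_ne_zero {q : ℂ} (hq : ‖q‖ < 1) (k : ℕ) : 1 - q ^ (k + 1) ≠ 0 := by
  intro h
  have h1 : ‖q ^ (k + 1)‖ = 1 := by rw [← sub_eq_zero.1 h, norm_one]
  rw [norm_pow] at h1
  exact absurd h1 (pow_lt_one₀ (norm_nonneg q) hq k.succ_ne_zero).ne

theorem summable_norm_mul_pow_succ (z : ℂ) {q : ℂ} (hq : ‖q‖ < 1) :
    Summable fun k : ℕ => ‖z * q ^ (k + 1)‖ := by
  simp only [norm_mul, norm_pow]
  exact (((summable_nat_add_iff 1).2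
    (summable_geometric_of_lt_one (norm_nonneg q) hq))).mul_left _

theorem multipliable_one_add_mul_pow (z : ℂ) {q : ℂ} (hq : ‖q‖ < 1) :
    Multipliable fun k : ℕ => 1 + z * q ^ (k + 1) :=
  multipliable_one_add_of_summable (summable_norm_mul_pow_succ z hq)

theorem tprod_one_add_mul_pow_ne_zero {z q : ℂ} (hz : ‖z‖ ≤ 1) (hq : ‖q‖ < 1) :
    ∏' k : ℕ, (1 + z * q ^ (k + 1)) ≠ 0 := by
  refine tprod_one_add_ne_zero_of_summable (fun k h => ?_) (summable_norm_mul_pow_succ z hq)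
  have h1 : ‖z * q ^ (k + 1)‖ = 1 := by
    rw [eq_neg_of_add_eq_zero_right h, norm_neg, norm_one]
  rw [norm_mul, norm_pow] at h1
  have h2 := pow_lt_one₀ (norm_nonneg q) hq k.succ_ne_zero
  exact (mul_lt_one_of_nonneg_of_lt_one_right hz (by positivity) h2).ne h1

theorem qProd_eq_tprod (q : ℂ) : qProd q = ∏' k : ℕ, (1 + -1 * q ^ (k + 1)) := by
  simp only [qProd, neg_one_mul, sub_eq_add_neg]

theorem qProd_ne_zero {q : ℂ} (hq : ‖q‖ < 1) : qProd q ≠ 0 := by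
  rw [qProd_eq_tprod]
  exact tprod_one_add_mul_pow_ne_zero (by simp) hq

theorem tendsto_qPoch {q : ℂ} (hq : ‖q‖ < 1) :
    Tendsto (qPoch q) atTop (𝓝 (qProd q)) :=
  (multipliable_qProd hq).tendsto_prod_tprod_nat

/-! ### Gaussian binomials and the finite triple product -/

/-- The reciprocal of `(q; q)_k`, extended by zero to negative `k`. -/
noncomputable def qPochInv (q : ℂ) (k : ℤ) : ℂ := if 0 ≤ k then (qPoch q k.toNat)⁻¹ else 0

/-- Extension by zero makes the recurrence valid for every integer: at k = 0 the factor 1 - q⁰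
vanishes. -/
theorem qPochInv_sub_one {q : ℂ} (hq : ‖q‖ < 1) (k : ℤ) :
    qPochInv q (k - 1) = (1 - q ^ k) * qPochInv q k := by
  rcases lt_trichotomy k 0 with h | rfl | h
  · rw [qPochInv, qPochInv, if_neg (by lia), if_neg (by lia), mul_zero]
  · simp [qPochInv]
  · obtain ⟨n, rfl⟩ : ∃ n : ℕ, k = (n + 1 : ℕ) := ⟨(k - 1).toNat, by lia⟩
    have h1 : ((n + 1 : ℕ) : ℤ) - 1 = n := by lia
    rw [h1, qPochInv, qPochInv, if_pos (by lia), if_pos (by lia), Int.toNat_natCast,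
      Int.toNat_natCast, zpow_natCast, qPoch, qPoch, Finset.prod_range_succ, mul_inv, mul_comm,
      mul_assoc, inv_mul_cancel₀ (one_sub_pow_succ_ne_zero hq n), mul_one]

/-- The central Gaussian binomial coefficients `(q; q)_{2n} / ((q; q)_{n-j} (q; q)_{n+j})`. -/
noncomputable def qCentral (q : ℂ) (n : ℕ) (j : ℤ) : ℂ :=
  qPoch q (2 * n) * (qPochInv q (n - j) * qPochInv q (n + j))

/-- This is the recurrence that multiplication by (1 + z q^(n+1))(1 + z⁻¹ qⁿ) imposes on
coefficients. All terms are multiples of one product of `qPochInv` values at a and b, which leaves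
an identity in q^a and q^b. -/
theorem qCentral_succ {q : ℂ} (hq0 : q ≠ 0) (hq : ‖q‖ < 1) (n : ℕ) (j : ℤ) :
    qCentral q (n + 1) j = (1 + q ^ (2 * n + 1)) * qCentral q n j +
      q ^ (n + 1 - j) * qCentral q n (j - 1) + q ^ (n + 1 + j) * qCentral q n (j + 1) := by
  obtain ⟨a, ha⟩ : ∃ a : ℤ, a = n + 1 - j := ⟨_, rfl⟩
  obtain ⟨b, hb⟩ : ∃ b : ℤ, b = n + 1 + j := ⟨_, rfl⟩
  have e1 : qPochInv q (a - 2) = (1 - q ^ a / q) * ((1 - q ^ a) * qPochInv q a) := by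
    rw [← qPochInv_sub_one hq, div_eq_mul_inv (q ^ _) q, ← zpow_sub_one₀ hq0,
      ← qPochInv_sub_one hq]
    congr 1; ring
  have e2 : qPochInv q (b - 2) = (1 - q ^ b / q) * ((1 - q ^ b) * qPochInv q b) := by
    rw [← qPochInv_sub_one hq, div_eq_mul_inv (q ^ _) q, ← zpow_sub_one₀ hq0,
      ← qPochInv_sub_one hq]
    congr 1; ring
  have hp : q ^ (2 * n + 1) = q ^ a * q ^ b / q := by
    rw [← zpow_add₀ hq0, div_eq_mul_inv (q ^ _) q, ← zpow_sub_one₀ hq0,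
      ← zpow_natCast]
    congr 1; push_cast; lia
  have hp2 : q ^ (2 * n + 2) = q ^ a * q ^ b := by
    rw [← zpow_add₀ hq0, ← zpow_natCast]; congr 1; push_cast; lia
  have hP : qPoch q (2 * (n + 1)) =
      qPoch q (2 * n) * (1 - q ^ a * q ^ b / q) * (1 - q ^ a * q ^ b) := by
    rw [← hp, ← hp2, show 2 * (n + 1) = 2 * n + 1 + 1 by ring, qPoch, Finset.prod_range_succ,
      Finset.prod_range_succ, ← qPoch]
  have i1 : ((n + 1 : ℕ) : ℤ) - j = a := by push_cast; lia
  have i2 : ((n + 1 : ℕ) : ℤ) + j = b := by push_cast; lia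
  have i3 : (n : ℤ) - j = a - 1 := by lia
  have i4 : (n : ℤ) + j = b - 1 := by lia
  have i5 : (n : ℤ) - (j - 1) = a := by lia
  have i6 : (n : ℤ) + (j - 1) = b - 2 := by lia
  have i7 : (n : ℤ) - (j + 1) = a - 2 := by lia
  have i8 : (n : ℤ) + (j + 1) = b := by lia
  rw [← ha, ← hb, qCentral, qCentral, qCentral, qCentral, i1, i2, i3, i4, i5, i6, i7, i8, hP, hp,
    e1, e2, qPochInv_sub_one hq, qPochInv_sub_one hq]
  field_simp
  ring

/-- The finite form of the Jacobi triple product identity. -/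
theorem hasSum_qCentral_mul {q z : ℂ} (hq0 : q ≠ 0) (hq : ‖q‖ < 1) (hz : z ≠ 0) {w : ℤ → ℂ}
    (hw : ∀ j, w (j + 1) = w j * (q ^ (j + 1) * z)) (n : ℕ) :
    HasSum (fun j => qCentral q n j * w j)
      (w 0 * ∏ k ∈ Finset.range n, (1 + z * q ^ (k + 1)) * (1 + z⁻¹ * q ^ k)) := by
  induction n with
  | zero =>
    have h : HasSum (fun j => qCentral q 0 j * w j) (qCentral q 0 0 * w 0) := by
      refine hasSum_single 0 fun j hj => ?_
      rcases lt_or_gt_of_ne hj with h | h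
      · simp [qCentral, qPochInv, not_le.2 h]
      · simp [qCentral, qPochInv, not_le.2 h]
    simpa [qCentral, qPochInv, qPoch] using h
  | succ n ih =>
    -- The recursion for `w` turns the two index shifts into the terms z q^(n+1) and z⁻¹ qⁿ of the
    -- new factor.
    have h1 := (Equiv.addRight (-1 : ℤ)).hasSum_iff.2 ih
    have h2 := (Equiv.addRight (1 : ℤ)).hasSum_iff.2 ih
    have h := ((ih.mul_left (1 + q ^ (2 * n + 1))).add (h1.mul_left (q ^ (n + 1) * z))).add
      (h2.mul_left (q ^ n * z⁻¹))
    have e1 : (fun j => qCentral q (n + 1) j * w j) = fun j =>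
        (1 + q ^ (2 * n + 1)) * (qCentral q n j * w j) +
          q ^ (n + 1) * z * (qCentral q n (j - 1) * w (j - 1)) +
          q ^ n * z⁻¹ * (qCentral q n (j + 1) * w (j + 1)) := by
      refine funext fun j => ?_
      have w1 : w j = w (j - 1) * (q ^ j * z) := by simpa using hw (j - 1)
      have w2 := hw j
      have hj := zpow_ne_zero j hq0
      have s1 : q ^ ((n : ℤ) + 1 - j) * qCentral q n (j - 1) * w j =
          q ^ (n + 1) * z * (qCentral q n (j - 1) * w (j - 1)) := by
        rw [w1, zpow_sub₀ hq0, show ((n : ℤ) + 1) = ((n + 1 : ℕ) : ℤ) by simp, zpow_natCast]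
        field_simp
      have s2 : q ^ ((n : ℤ) + 1 + j) * qCentral q n (j + 1) * w j =
          q ^ n * z⁻¹ * (qCentral q n (j + 1) * w (j + 1)) := by
        rw [w2, add_assoc, add_comm (1 : ℤ), zpow_add₀ hq0, zpow_natCast]
        field_simp
      rw [qCentral_succ hq0 hq, add_mul, add_mul, s1, s2, mul_assoc]
    have e2 : (1 + z * q ^ (n + 1)) * (1 + z⁻¹ * q ^ n) =
        1 + q ^ (2 * n + 1) + q ^ (n + 1) * z + q ^ n * z⁻¹ := by
      field_simp
      ring
    rw [e1, Finset.prod_range_succ, e2, mul_comm (∏ k ∈ _, _), mul_left_comm, add_mul, add_mul]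
    exact h

/-! ### Passage to the limit: the Jacobi triple product -/

theorem tendsto_qCentral {q : ℂ} (hq : ‖q‖ < 1) (j : ℤ) :
    Tendsto (fun n => qCentral q n j) atTop (𝓝 (qProd q)⁻¹) := by
  have key : ∀ i : ℤ, Tendsto (fun n : ℕ => qPochInv q (n + i)) atTop (𝓝 (qProd q)⁻¹) := by
    intro i
    have ht : Tendsto (fun n : ℕ => ((n : ℤ) + i).toNat) atTop atTop := by
      refine tendsto_atTop.2 fun b => ?_
      filter_upwards [eventually_ge_atTop (b + i.natAbs)] with n hn
      lia
    refine (((tendsto_qPoch hq).comp ht).inv₀ (qProd_ne_zero hq)).congr' ?_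
    filter_upwards [eventually_ge_atTop i.natAbs] with n hn
    rw [qPochInv, if_pos (by lia)]
    rfl
  have h2 : Tendsto (fun n : ℕ => qPoch q (2 * n)) atTop (𝓝 (qProd q)) :=
    (tendsto_qPoch hq).comp (tendsto_id.const_mul_atTop' two_pos)
  have h := h2.mul ((key (-j)).mul (key j))
  rw [mul_inv_cancel_left₀ (qProd_ne_zero hq)] at h
  exact h

/-- Uniformity in both n and j supplies the bound for dominated convergence. -/
theorem exists_norm_qCentral_le {q : ℂ} (hq : ‖q‖ < 1) :
    ∃ C, ∀ n j, ‖qCentral q n j‖ ≤ C := by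
  obtain ⟨C₁, h₁⟩ := (tendsto_qPoch hq).norm.bddAbove_range
  obtain ⟨C₂, h₂⟩ := ((tendsto_qPoch hq).inv₀ (qProd_ne_zero hq)).norm.bddAbove_range
  have h₁' : ∀ n, ‖qPoch q n‖ ≤ C₁ := fun n => h₁ ⟨n, rfl⟩
  have h₂' : ∀ k, ‖qPochInv q k‖ ≤ C₂ := by
    intro k
    rw [qPochInv]
    split_ifs
    · exact h₂ ⟨_, rfl⟩
    · rw [norm_zero]; exact (norm_nonneg _).trans (h₂ ⟨0, rfl⟩)
  have hC₂ := (norm_nonneg _).trans (h₂' 0)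
  refine ⟨C₁ * (C₂ * C₂), fun n j => ?_⟩
  rw [qCentral, norm_mul, norm_mul]
  gcongr
  · exact (norm_nonneg _).trans (h₁' 0)
  · exact h₁' _
  · exact h₂' _
  · exact h₂' _

theorem tendsto_tsum_qCentral_mul {q : ℂ} (hq : ‖q‖ < 1) {u : ℤ → ℂ} (hu : Summable u) :
    Tendsto (fun n => ∑' j, qCentral q n j * u j) atTop (𝓝 ((qProd q)⁻¹ * ∑' j, u j)) := by
  obtain ⟨C, hC⟩ := exists_norm_qCentral_le hq
  rw [← tsum_mul_left]
  refine tendsto_tsum_of_dominated_convergence (bound := fun j => C * ‖u j‖)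
    (hu.norm.mul_left C) (fun j => (tendsto_qCentral hq j).mul_const _)
    (Eventually.of_forall fun n j => ?_)
  rw [norm_mul]
  gcongr
  exact hC n j

/-- The Jacobi triple product identity, for a bilateral sequence `w` with
`w (j + 1) = w j * q ^ (j + 1) * z`. -/
theorem tsum_eq_mul_tprod {q z : ℂ} (hq0 : q ≠ 0) (hq : ‖q‖ < 1) (hz : z ≠ 0) {w : ℤ → ℂ}
    (hw : ∀ j, w (j + 1) = w j * (q ^ (j + 1) * z)) (hs : Summable w) :
    ∑' j, w j = w 0 * (1 + z⁻¹) * qProd q * (∏' k : ℕ, (1 + z * q ^ (k + 1))) *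
      ∏' k : ℕ, (1 + z⁻¹ * q ^ (k + 1)) := by
  have h1 := tendsto_tsum_qCentral_mul hq hs
  -- The finite product in z⁻¹ starts at q⁰ and stops at q^(n-1). An extra factor, tending to 1,
  -- lets 1 + z⁻¹ be split off with n factors left over.
  have h2 : Tendsto (fun n : ℕ => 1 + z⁻¹ * q ^ n) atTop (𝓝 1) := by
    simpa using ((tendsto_pow_atTop_nhds_zero_of_norm_lt_one hq).const_mul z⁻¹).const_add 1
  have h3 := (((multipliable_one_add_mul_pow z hq).tendsto_prod_tprod_nat).mul
    ((multipliable_one_add_mul_pow z⁻¹ hq).tendsto_prod_tprod_nat)).const_mul (w 0 * (1 + z⁻¹))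
  have h4 := h1.mul h2
  have h5 := tendsto_nhds_unique (h4.congr fun n => ?_) h3
  · rw [mul_one, inv_mul_eq_iff_eq_mul₀ (qProd_ne_zero hq)] at h5
    rw [h5]; ring
  · rw [(hasSum_qCentral_mul hq0 hq hz hw n).tsum_eq, Finset.prod_mul_distrib, mul_assoc, mul_assoc,
      ← Finset.prod_range_succ (fun k => 1 + z⁻¹ * q ^ k), Finset.prod_range_succ', pow_zero]
    ring

/-! ### Jacobi's cube identity -/

theorem qCentral_eq_zero {q : ℂ} {n : ℕ} {j : ℤ} (hj : j ∉ Finset.Icc (-n : ℤ) n) :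
    qCentral q n j = 0 := by
  rw [Finset.mem_Icc, not_and_or] at hj
  rcases hj with h | h
  · rw [qCentral, qPochInv, qPochInv, if_neg (by lia : ¬(0 : ℤ) ≤ n + j), mul_zero, mul_zero]
  · rw [qCentral, qPochInv, if_neg (by lia), zero_mul, mul_zero]

/-- The finite triple product at z = -y is differentiated at y = 1. The factor 1 - y⁻¹ vanishes
there with derivative 1, so only the value of the remaining factors survives. -/
theorem tsum_qCentral_mul_int {q : ℂ} (hq0 : q ≠ 0) (hq : ‖q‖ < 1) {w : ℤ → ℂ}
    (hw : ∀ j, w (j + 1) = w j * (q ^ (j + 1) * -1)) (n : ℕ) :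
    ∑' j, qCentral q (n + 1) j * (j * w j) = w 0 * qPoch q (n + 1) * qPoch q n := by
  have hf : ∀ y : ℂ, y ≠ 0 →
      ∑ j ∈ Finset.Icc (-(n + 1 : ℕ) : ℤ) (n + 1 : ℕ), qCentral q (n + 1) j * w j * y ^ j =
      w 0 * (∏ k ∈ Finset.range (n + 1), (1 - y * q ^ (k + 1))) *
        (∏ k ∈ Finset.range n, (1 - y⁻¹ * q ^ (k + 1))) * (1 - y⁻¹) := by
    intro y hy
    have h := hasSum_qCentral_mul hq0 hq (neg_ne_zero.2 hy) (w := fun j => w j * y ^ j)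
      (fun j => by rw [hw, zpow_add_one₀ hy]; ring) (n + 1)
    have h' : HasSum (fun j => qCentral q (n + 1) j * w j * y ^ j) _ :=
      hasSum_sum_of_ne_finset_zero (s := Finset.Icc (-(n + 1 : ℕ) : ℤ) (n + 1 : ℕ))
        fun j hj => by rw [qCentral_eq_zero hj, zero_mul, zero_mul]
    simp only [← mul_assoc] at h
    rw [h'.unique h, Finset.prod_mul_distrib, Finset.prod_range_succ' (fun k => 1 + (-y)⁻¹ * q ^ k)]
    simp [inv_neg, sub_eq_add_neg]
    ring
  have hd : HasDerivAt
      (fun y : ℂ => ∑ j ∈ Finset.Icc (-(n + 1 : ℕ) : ℤ) (n + 1 : ℕ),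
        qCentral q (n + 1) j * w j * y ^ j)
      (∑ j ∈ Finset.Icc (-(n + 1 : ℕ) : ℤ) (n + 1 : ℕ),
        qCentral q (n + 1) j * w j * (j * 1 ^ (j - 1))) 1 :=
    HasDerivAt.fun_sum fun j _ => (hasDerivAt_zpow j 1 (Or.inl one_ne_zero)).const_mul _
  have hG : DifferentiableAt ℂ (fun y : ℂ =>
      w 0 * (∏ k ∈ Finset.range (n + 1), (1 - y * q ^ (k + 1))) *
        (∏ k ∈ Finset.range n, (1 - y⁻¹ * q ^ (k + 1)))) 1 := by
    refine ((DifferentiableAt.fun_finsetProd fun k _ => ?_).const_mul _).mul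
      (DifferentiableAt.fun_finsetProd fun k _ => ?_)
    · fun_prop
    · exact ((differentiableAt_inv one_ne_zero).mul_const _).const_sub _
  have hd' := hG.hasDerivAt.mul ((hasDerivAt_inv (one_ne_zero (α := ℂ))).const_sub 1)
  have hd'' := hd.congr_of_eventuallyEq
    ((eventually_ne_nhds one_ne_zero).mono fun y hy => (hf y hy).symm)
  have h := hd''.unique hd'
  rw [tsum_eq_sum (s := Finset.Icc (-(n + 1 : ℕ) : ℤ) (n + 1 : ℕ))
    fun j hj => by rw [qCentral_eq_zero hj, zero_mul]]
  simp only [one_zpow, mul_one, inv_one, sub_self, mul_zero, zero_add, one_mul, one_pow, neg_neg]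
    at h
  rw [qPoch, qPoch, ← h]
  exact Finset.sum_congr rfl fun j _ => by ring

/-- Jacobi's identity for the cube of `(q; q)_∞`, for a bilateral sequence `w` with
`w (j + 1) = -w j * q ^ (j + 1)`. -/
theorem tsum_int_mul_eq_qProd_cube {q : ℂ} (hq0 : q ≠ 0) (hq : ‖q‖ < 1) {w : ℤ → ℂ}
    (hw : ∀ j, w (j + 1) = w j * (q ^ (j + 1) * -1)) (hs : Summable fun j : ℤ => j * w j) :
    ∑' j : ℤ, j * w j = w 0 * qProd q ^ 3 := by
  have h1 := (tendsto_tsum_qCentral_mul hq hs).comp (tendsto_add_atTop_nat 1)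
  have h2 := (((tendsto_qPoch hq).comp (tendsto_add_atTop_nat 1)).const_mul (w 0)).mul
    (tendsto_qPoch hq)
  have h := tendsto_nhds_unique
    (h1.congr fun n => tsum_qCentral_mul_int hq0 hq hw n) h2
  rw [inv_mul_eq_iff_eq_mul₀ (qProd_ne_zero hq)] at h
  rw [h]; ring

/-! ### Theta series: heat equation and symmetries -/

theorem qVar_add (x y : ℂ) : qVar (x + y) = qVar x * qVar y := by
  rw [qVar, mul_add, Complex.exp_add, qVar, qVar]

theorem qVar_zero : qVar 0 = 1 := by simp [qVar]

theorem qVar_ne_zero (x : ℂ) : qVar x ≠ 0 := Complex.exp_ne_zero _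

theorem qVar_neg (x : ℂ) : qVar (-x) = (qVar x)⁻¹ := by
  rw [qVar, mul_neg, Complex.exp_neg, qVar]

theorem qVar_int_mul (n : ℤ) (x : ℂ) : qVar (n * x) = qVar x ^ n := by
  rw [qVar, qVar, ← Complex.exp_int_mul]; congr 1; ring

theorem qVar_nat_mul (n : ℕ) (x : ℂ) : qVar (n * x) = qVar x ^ n := by
  exact_mod_cast qVar_int_mul n x

theorem qVar_int (n : ℤ) : qVar n = 1 := by
  rw [qVar, mul_comm, Complex.exp_int_mul_two_pi_mul_I]

theorem qVar_half : qVar (1 / 2) = -1 := by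
  rw [qVar, ← Complex.exp_pi_mul_I]; congr 1; ring

theorem qVar_quarter : qVar (1 / 4) = Complex.I := by
  rw [qVar, show 2 * Real.pi * Complex.I * (1 / 4) = Real.pi / 2 * Complex.I by ring,
    Complex.exp_pi_div_two_mul_I]

theorem norm_qVar_lt_one {τ : ℂ} (hτ : 0 < τ.im) : ‖qVar τ‖ < 1 := by
  have h := Function.Periodic.norm_qParam_lt_one one_pos hτ
  rwa [Function.Periodic.qParam, Complex.ofReal_one, div_one] at h

/-- The general term of the theta series with characteristic `s`, weighted by `(n + s) ^ k`. -/
noncomputable def thetaTerm (k : ℕ) (s z τ : ℂ) (n : ℤ) : ℂ :=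
  (n + s) ^ k * qVar (1 / 2 * (n + s) ^ 2 * τ + (n + s) * z)

/-- The theta series with characteristic `s`, weighted by `(n + s) ^ k`. -/
noncomputable def thetaSum (k : ℕ) (s z τ : ℂ) : ℂ := ∑' n : ℤ, thetaTerm k s z τ n

theorem thetaChar_eq_thetaSum (ε ε' : ℝ) (ζ τ : ℂ) :
    thetaChar ε ε' ζ τ = thetaSum 0 (ε / 2) (ζ + ε' / 2) τ := by
  simp [thetaChar, thetaSum, thetaTerm, qVar]

theorem thetaTerm_eq_jacobiTheta₂_term (k : ℕ) (s z τ : ℂ) (n : ℤ) :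
    thetaTerm k s z τ n = qVar (1 / 2 * s ^ 2 * τ + s * z) *
      ((n + s) ^ k * jacobiTheta₂_term n (z + s * τ) τ) := by
  rw [thetaTerm, jacobiTheta₂_term, qVar, qVar, mul_left_comm, ← Complex.exp_add]
  congr 2; ring

theorem summable_pow_mul_jacobiTheta₂_term (k : ℕ) (z : ℂ) {τ : ℂ} (hτ : 0 < τ.im) :
    Summable fun n : ℤ => (n : ℂ) ^ k * jacobiTheta₂_term n z τ := by
  refine (summable_pow_mul_jacobiTheta₂_term_bound |z.im| hτ k).of_norm_bounded fun n => ?_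
  rw [norm_mul, norm_pow, Complex.norm_intCast, Int.cast_abs, ← Int.cast_abs]
  gcongr
  exact norm_jacobiTheta₂_term_le hτ le_rfl le_rfl n

theorem summable_thetaTerm (k : ℕ) (s z : ℂ) {τ : ℂ} (hτ : 0 < τ.im) :
    Summable (thetaTerm k s z τ) := by
  have h : Summable fun n : ℤ => ∑ i ∈ Finset.range (k + 1), s ^ (k - i) * k.choose i *
      ((n : ℂ) ^ i * jacobiTheta₂_term n (z + s * τ) τ) :=
    summable_sum fun i _ => (summable_pow_mul_jacobiTheta₂_term i _ hτ).mul_left _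
  refine (h.mul_left (qVar (1 / 2 * s ^ 2 * τ + s * z))).congr fun n => ?_
  rw [thetaTerm_eq_jacobiTheta₂_term, add_pow, Finset.sum_mul]
  congr 1
  exact Finset.sum_congr rfl fun i _ => by ring

/-- The heat equation for theta series. -/
theorem hasDerivAt_thetaSum (s z : ℂ) {τ : ℂ} (hτ : 0 < τ.im) :
    HasDerivAt (thetaSum 0 s z) (Real.pi * Complex.I * thetaSum 2 s z τ) τ := by
  -- Expanding (n + s)² moves the characteristic into the first argument of `jacobiTheta₂`, which is
  -- then differentiated along t ↦ (z + s t, t).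
  have hfun : thetaSum 0 s z = fun t =>
      qVar (1 / 2 * s ^ 2 * t + s * z) * jacobiTheta₂ (z + s * t) t := by
    funext t
    simp only [thetaSum, thetaTerm_eq_jacobiTheta₂_term, pow_zero, one_mul, tsum_mul_left,
      jacobiTheta₂]
  have h1 : HasDerivAt (fun t => qVar (1 / 2 * s ^ 2 * t + s * z))
      (qVar (1 / 2 * s ^ 2 * τ + s * z) * (2 * Real.pi * Complex.I * (1 / 2 * s ^ 2 * 1))) τ :=
    ((((hasDerivAt_id τ).const_mul (1 / 2 * s ^ 2)).add_const (s * z)).const_mul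
      (2 * Real.pi * Complex.I)).cexp
  have h2 : HasDerivAt (fun t : ℂ => (z + s * t, t)) (s * 1, 1) τ :=
    (((hasDerivAt_id τ).const_mul s).const_add z).prodMk (hasDerivAt_id τ)
  have h3 := HasFDerivAt.comp_hasDerivAt (f := fun t : ℂ => (z + s * t, t)) τ
    (hasFDerivAt_jacobiTheta₂ (z + s * τ) hτ) h2
  have h4 : HasSum (fun n => jacobiTheta₂_term_fderiv n (z + s * τ) τ (s * 1, 1)) _ :=
    (hasSum_jacobiTheta₂_term_fderiv (z + s * τ) hτ).mapL
      (ContinuousLinearMap.apply ℂ ℂ ((s * 1, 1) : ℂ × ℂ))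
  have h5 := ((hasSum_jacobiTheta₂_term (z + s * τ) hτ).mul_left
    (qVar (1 / 2 * s ^ 2 * τ + s * z) * (2 * Real.pi * Complex.I * (1 / 2 * s ^ 2 * 1)))).add
    (h4.mul_left (qVar (1 / 2 * s ^ 2 * τ + s * z)))
  rw [hfun]
  refine (h1.mul h3).congr_deriv (h5.tsum_eq.symm.trans ?_)
  rw [thetaSum, ← tsum_mul_left]
  refine tsum_congr fun n => ?_
  rw [thetaTerm_eq_jacobiTheta₂_term]
  simp [jacobiTheta₂_term_fderiv, jacobiTheta₂_term]
  ring

theorem thetaSum_add_one_char (k : ℕ) (s z τ : ℂ) : thetaSum k (s + 1) z τ = thetaSum k s z τ := by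
  rw [thetaSum, thetaSum, ← (Equiv.addRight (1 : ℤ)).tsum_eq (thetaTerm k s z τ)]
  refine tsum_congr fun n => ?_
  simp only [thetaTerm, Equiv.coe_addRight]
  push_cast
  rw [add_right_comm, add_assoc]

theorem thetaSum_neg (k : ℕ) (s z τ : ℂ) :
    thetaSum k (-s) (-z) τ = (-1) ^ k * thetaSum k s z τ := by
  rw [thetaSum, thetaSum, ← (Equiv.neg ℤ).tsum_eq (thetaTerm k (-s) (-z) τ), ← tsum_mul_left]
  refine tsum_congr fun n => ?_
  simp only [thetaTerm, Equiv.neg_apply]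
  rw [← mul_assoc, ← mul_pow]
  push_cast
  congr 2 <;> ring

theorem thetaSum_half_neg (k : ℕ) (z τ : ℂ) :
    thetaSum k (1 / 2) (-z) τ = (-1) ^ k * thetaSum k (1 / 2) z τ := by
  rw [← thetaSum_neg, ← thetaSum_add_one_char k (-(1 / 2))]; norm_num

theorem thetaSum_zero_neg (k : ℕ) (z τ : ℂ) :
    thetaSum k 0 (-z) τ = (-1) ^ k * thetaSum k 0 z τ := by
  rw [← thetaSum_neg, neg_zero]

theorem thetaSum_add_one (k : ℕ) (s z τ : ℂ) :
    thetaSum k s (z + 1) τ = qVar s * thetaSum k s z τ := by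
  rw [thetaSum, thetaSum, ← tsum_mul_left]
  refine tsum_congr fun n => ?_
  rw [thetaTerm, thetaTerm, show 1 / 2 * (n + s) ^ 2 * τ + (n + s) * (z + 1) =
    1 / 2 * (n + s) ^ 2 * τ + (n + s) * z + s + n by ring, qVar_add _ (n : ℂ), qVar_int,
    qVar_add _ s]
  ring

/-- Since (n + 1/2)²/2 = 1/8 + n(n+1)/2 and n(n+1)/2 is an integer, the factor depends on neither n
nor z; it therefore cancels in W. -/
theorem thetaSum_half_add_one_period (k : ℕ) (z τ : ℂ) :
    thetaSum k (1 / 2) z (τ + 1) = qVar (1 / 8) * thetaSum k (1 / 2) z τ := by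
  rw [thetaSum, thetaSum, ← tsum_mul_left]
  refine tsum_congr fun n => ?_
  obtain ⟨m, hm⟩ := Int.even_mul_succ_self n
  have hm' : (n : ℂ) * (n + 1) = m + m := by exact_mod_cast hm
  rw [thetaTerm, thetaTerm, show 1 / 2 * (n + 1 / 2) ^ 2 * (τ + 1) + (n + 1 / 2) * z =
    1 / 2 * (n + 1 / 2) ^ 2 * τ + (n + 1 / 2) * z + 1 / 8 + m by linear_combination hm' / 2,
    qVar_add _ (m : ℂ), qVar_int, qVar_add _ (1 / 8)]
  ring

/-! ### Products of two theta series -/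

/-- Pairs of integers, split according to the parity of their sum and parametrized by
half their sum and half their difference. -/
def intPairParityEquiv : (ℤ × ℤ) ⊕ (ℤ × ℤ) ≃ ℤ × ℤ where
  toFun := Sum.elim (fun p => (p.1 + p.2, p.1 - p.2)) (fun p => (p.1 + p.2, p.1 - p.2 - 1))
  invFun p := if (p.1 + p.2) % 2 = 0 then Sum.inl ((p.1 + p.2) / 2, (p.1 - p.2) / 2)
    else Sum.inr ((p.1 + p.2 + 1) / 2, (p.1 - p.2 - 1) / 2)
  left_inv := by
    rintro (⟨a, b⟩ | ⟨a, b⟩)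
    · refine (if_pos (by simp only [Sum.elim_inl]; lia)).trans ?_
      simp only [Sum.elim_inl]
      congr 2 <;> lia
    · refine (if_neg (by simp only [Sum.elim_inr]; lia)).trans ?_
      simp only [Sum.elim_inr]
      congr 2 <;> lia
  right_inv := by
    rintro ⟨m, n⟩
    simp only
    split_ifs
    · simp only [Sum.elim_inl]; congr 1 <;> lia
    · simp only [Sum.elim_inr]; congr 1 <;> lia

theorem tsum_int_prod_parity {F : ℤ × ℤ → ℂ} (hF : Summable F) :
    ∑' p, F p = ∑' p : ℤ × ℤ, F (p.1 + p.2, p.1 - p.2) +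
      ∑' p : ℤ × ℤ, F (p.1 + p.2, p.1 - p.2 - 1) := by
  have h := (intPairParityEquiv.summable_iff.2 hF)
  rw [← intPairParityEquiv.tsum_eq F]
  exact (h.comp_injective Sum.inl_injective).tsum_sum (h.comp_injective Sum.inr_injective)

theorem summable_thetaTerm_mul (k l : ℕ) (s t z w : ℂ) {τ : ℂ} (hτ : 0 < τ.im) :
    Summable fun p : ℤ × ℤ => thetaTerm k s z τ p.1 * thetaTerm l t w τ p.2 :=
  summable_mul_of_summable_norm (summable_thetaTerm k s z hτ).norm
    (summable_thetaTerm l t w hτ).norm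

theorem thetaSum_mul_thetaSum (k l : ℕ) (s t z w : ℂ) {τ : ℂ} (hτ : 0 < τ.im) :
    thetaSum k s z τ * thetaSum l t w τ =
      ∑' p : ℤ × ℤ, thetaTerm k s z τ p.1 * thetaTerm l t w τ p.2 :=
  tsum_mul_tsum_of_summable_norm (summable_thetaTerm k s z hτ).norm
    (summable_thetaTerm l t w hτ).norm

theorem im_two_mul_pos {τ : ℂ} (hτ : 0 < τ.im) : 0 < (2 * τ).im := by
  simpa using hτ

/-- The parallelogram law M² + N² = 2(S² + D²) separates the variables. -/
theorem qVar_theta_mul {M N S D z w τ : ℂ} (hS : M + N = 2 * S) (hD : M - N = 2 * D) :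
    qVar (1 / 2 * M ^ 2 * τ + M * z) * qVar (1 / 2 * N ^ 2 * τ + N * w) =
      qVar (1 / 2 * S ^ 2 * (2 * τ) + S * (z + w)) *
        qVar (1 / 2 * D ^ 2 * (2 * τ) + D * (z - w)) := by
  obtain rfl : M = S + D := by linear_combination (hS + hD) / 2
  obtain rfl : N = S - D := by linear_combination (hS - hD) / 2
  rw [← qVar_add, ← qVar_add]
  congr 1; ring

/-- The product of two theta series in terms of theta series at `2 * τ`. -/
theorem thetaSum_mul_duplication (s z w : ℂ) {τ : ℂ} (hτ : 0 < τ.im) :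
    thetaSum 0 s z τ * thetaSum 0 s w τ =
      thetaSum 0 s (z + w) (2 * τ) * thetaSum 0 0 (z - w) (2 * τ) +
      thetaSum 0 (s - 1 / 2) (z + w) (2 * τ) * thetaSum 0 (1 / 2) (z - w) (2 * τ) := by
  have h2 := im_two_mul_pos hτ
  rw [thetaSum_mul_thetaSum _ _ _ _ _ _ hτ, thetaSum_mul_thetaSum _ _ _ _ _ _ h2,
    thetaSum_mul_thetaSum _ _ _ _ _ _ h2,
    tsum_int_prod_parity (summable_thetaTerm_mul 0 0 s s z w hτ)]
  congr 1 <;>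
  · refine tsum_congr fun p => ?_
    simp only [thetaTerm, pow_zero, one_mul]
    refine qVar_theta_mul ?_ ?_ <;> push_cast <;> ring

/-- The Wronskian of two theta series in terms of theta series at `2 * τ`. -/
theorem thetaSum_wronskian (s z w : ℂ) {τ : ℂ} (hτ : 0 < τ.im) :
    thetaSum 2 s z τ * thetaSum 0 s w τ - thetaSum 0 s z τ * thetaSum 2 s w τ =
      4 * (thetaSum 1 s (z + w) (2 * τ) * thetaSum 1 0 (z - w) (2 * τ) +
      thetaSum 1 (s - 1 / 2) (z + w) (2 * τ) * thetaSum 1 (1 / 2) (z - w) (2 * τ)) := by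
  have h2 := im_two_mul_pos hτ
  have hs1 := summable_thetaTerm_mul 2 0 s s z w hτ
  have hs2 := summable_thetaTerm_mul 0 2 s s z w hτ
  -- The weight M² - N² = 4SD factors, so each parity class splits into a product of weight-one
  -- series.
  have key : ∀ {M N S D : ℂ}, M + N = 2 * S → M - N = 2 * D →
      M ^ 2 * qVar (1 / 2 * M ^ 2 * τ + M * z) *
        (N ^ 0 * qVar (1 / 2 * N ^ 2 * τ + N * w)) -
      M ^ 0 * qVar (1 / 2 * M ^ 2 * τ + M * z) *
        (N ^ 2 * qVar (1 / 2 * N ^ 2 * τ + N * w)) =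
      4 * (S ^ 1 * qVar (1 / 2 * S ^ 2 * (2 * τ) + S * (z + w)) *
        (D ^ 1 * qVar (1 / 2 * D ^ 2 * (2 * τ) + D * (z - w)))) := by
    intro M N S D hS hD
    have h := qVar_theta_mul (τ := τ) (z := z) (w := w) hS hD
    have h' : M ^ 2 - N ^ 2 = 4 * (S * D) := by linear_combination (M - N) * hS + 2 * S * hD
    linear_combination (M ^ 2 - N ^ 2) * h + qVar (1 / 2 * S ^ 2 * (2 * τ) + S * (z + w)) *
        qVar (1 / 2 * D ^ 2 * (2 * τ) + D * (z - w)) * h'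
  rw [thetaSum_mul_thetaSum _ _ _ _ _ _ hτ, thetaSum_mul_thetaSum _ _ _ _ _ _ hτ,
    thetaSum_mul_thetaSum _ _ _ _ _ _ h2, thetaSum_mul_thetaSum _ _ _ _ _ _ h2,
    ← hs1.tsum_sub hs2, tsum_int_prod_parity (hs1.sub hs2), mul_add, ← tsum_mul_left,
    ← tsum_mul_left]
  congr 1 <;>
  · refine tsum_congr fun p => ?_
    simp only [thetaTerm]
    refine key ?_ ?_ <;> push_cast <;> ring

/-! ### Product expansions and special values -/

theorem thetaTerm_succ (s z τ : ℂ) (j : ℤ) : thetaTerm 0 s z τ (j + 1) =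
    thetaTerm 0 s z τ j * (qVar τ ^ (j + 1) * qVar (z + (s - 1 / 2) * τ)) := by
  simp only [thetaTerm, pow_zero, one_mul]
  rw [← qVar_int_mul, ← qVar_add, ← qVar_add]
  congr 1; push_cast; ring

/-- The product expansion of theta series. -/
theorem thetaSum_eq_tprod (s z : ℂ) {τ : ℂ} (hτ : 0 < τ.im) :
    thetaSum 0 s z τ = qVar (1 / 2 * s ^ 2 * τ + s * z) *
      (1 + (qVar (z + (s - 1 / 2) * τ))⁻¹) * qProd (qVar τ) *
      (∏' k : ℕ, (1 + qVar (z + (s - 1 / 2) * τ) * qVar τ ^ (k + 1))) *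
      ∏' k : ℕ, (1 + (qVar (z + (s - 1 / 2) * τ))⁻¹ * qVar τ ^ (k + 1)) := by
  rw [thetaSum, tsum_eq_mul_tprod (qVar_ne_zero _) (norm_qVar_lt_one hτ) (qVar_ne_zero _)
    (thetaTerm_succ s z τ) (summable_thetaTerm 0 s z hτ)]
  simp [thetaTerm]

/-- In the weight n + 1/2, the constant 1/2 contributes nothing because the triple product has the
factor 1 + (-1)⁻¹ = 0. The weight n gives Jacobi's cube. -/
theorem thetaSum_one_half_half {τ : ℂ} (hτ : 0 < τ.im) :
    thetaSum 1 (1 / 2) (1 / 2) τ = Complex.I * qVar (τ / 8) * qProd (qVar τ) ^ 3 := by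
  have hw := thetaTerm_succ (1 / 2) (1 / 2) τ
  simp only [sub_self, zero_mul, add_zero, qVar_half] at hw
  have hs := summable_thetaTerm 0 (1 / 2) (1 / 2) hτ
  have h0 : ∑' j, thetaTerm 0 (1 / 2) (1 / 2) τ j = 0 := by
    rw [tsum_eq_mul_tprod (qVar_ne_zero _) (norm_qVar_lt_one hτ) (by norm_num) hw hs]
    norm_num
  have hfun : ∀ j : ℤ, thetaTerm 1 (1 / 2) (1 / 2) τ j =
      j * thetaTerm 0 (1 / 2) (1 / 2) τ j + 1 / 2 * thetaTerm 0 (1 / 2) (1 / 2) τ j := by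
    intro j; simp only [thetaTerm]; ring
  have hs1 : Summable fun j : ℤ => (j : ℂ) * thetaTerm 0 (1 / 2) (1 / 2) τ j :=
    ((summable_thetaTerm 1 (1 / 2) (1 / 2) hτ).sub (hs.mul_left (1 / 2))).congr fun j => by
      rw [hfun]; ring
  rw [thetaSum, tsum_congr hfun, hs1.tsum_add (hs.mul_left _), tsum_mul_left, h0, mul_zero,
    add_zero, tsum_int_mul_eq_qProd_cube (qVar_ne_zero _) (norm_qVar_lt_one hτ) hw hs1, thetaTerm,
    ← qVar_quarter, ← qVar_add, pow_zero, one_mul]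
  congr 2
  push_cast; ring

/-- The series is odd in z, and ±1/2 differ by the period 1. -/
theorem thetaSum_one_zero_half (τ : ℂ) : thetaSum 1 0 (1 / 2) τ = 0 := by
  have h1 := thetaSum_add_one 1 0 (-(1 / 2)) τ
  rw [thetaSum_zero_neg, qVar_zero, show -(1 / 2 : ℂ) + 1 = 1 / 2 by norm_num] at h1
  linear_combination h1 / 2

theorem thetaSum_zero_half_half (τ : ℂ) : thetaSum 0 (1 / 2) (1 / 2) τ = 0 := by
  have h1 := thetaSum_add_one 0 (1 / 2) (-(1 / 2)) τ
  rw [thetaSum_half_neg, qVar_half, show -(1 / 2 : ℂ) + 1 = 1 / 2 by norm_num] at h1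
  linear_combination h1 / 2

theorem HasSum.int_even_add_odd {f : ℤ → ℂ} {a b : ℂ} (he : HasSum (fun n => f (2 * n)) a)
    (ho : HasSum (fun n => f (2 * n + 1)) b) : HasSum f (a + b) := by
  have := mul_right_injective₀ (two_ne_zero' ℤ)
  replace he := this.hasSum_range_iff.2 he
  replace ho := ((add_left_injective 1).comp this).hasSum_range_iff.2 ho
  refine he.add_isCompl ?_ ho
  simpa [Function.comp_def] using Int.isCompl_even_odd

/-- The sum is split by the parity of n; the even part is the vanishing series at z = 1/2. -/
theorem thetaSum_one_zero_quarter {τ : ℂ} (hτ : 0 < τ.im) :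
    thetaSum 1 0 (1 / 4) τ = 2 * thetaSum 1 (1 / 2) (1 / 2) (4 * τ) := by
  have h4 : 0 < (4 * τ).im := by simpa using hτ
  have he : HasSum (fun n : ℤ => thetaTerm 1 0 (1 / 4) τ (2 * n))
      (2 * thetaSum 1 0 (1 / 2) (4 * τ)) := by
    suffices e : (fun n : ℤ => thetaTerm 1 0 (1 / 4) τ (2 * n)) =
        fun n => 2 * thetaTerm 1 0 (1 / 2) (4 * τ) n by
      rw [e]; exact (summable_thetaTerm 1 0 (1 / 2) h4).hasSum.mul_left 2
    refine funext fun n => ?_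
    simp only [thetaTerm]
    rw [← mul_assoc]
    push_cast
    congr 2 <;> ring
  have ho : HasSum (fun n : ℤ => thetaTerm 1 0 (1 / 4) τ (2 * n + 1))
      (2 * thetaSum 1 (1 / 2) (1 / 2) (4 * τ)) := by
    suffices e : (fun n : ℤ => thetaTerm 1 0 (1 / 4) τ (2 * n + 1)) =
        fun n => 2 * thetaTerm 1 (1 / 2) (1 / 2) (4 * τ) n by
      rw [e]; exact (summable_thetaTerm 1 (1 / 2) (1 / 2) h4).hasSum.mul_left 2
    refine funext fun n => ?_
    simp only [thetaTerm]
    rw [← mul_assoc]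
    push_cast
    congr 2 <;> ring
  rw [thetaSum, (he.int_even_add_odd ho).tsum_eq, thetaSum_one_zero_half]
  ring

theorem tprod_one_add_mul_qProd {q : ℂ} (hq : ‖q‖ < 1) :
    (∏' k : ℕ, (1 + 1 * q ^ (k + 1))) * qProd q = qProd (q ^ 2) := by
  rw [qProd, ← (multipliable_one_add_mul_pow 1 hq).tprod_mul (multipliable_qProd hq), qProd]
  exact tprod_congr fun k => by ring

/-- The four linear factors at the primitive eighth roots of unity. -/
theorem tprod_primitive_eighth_roots {ζ q : ℂ} (hζ : ζ ^ 4 = -1) (hq : ‖q‖ < 1) :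
    (∏' k : ℕ, (1 + ζ * q ^ (k + 1))) * (∏' k : ℕ, (1 + ζ⁻¹ * q ^ (k + 1))) *
      ((∏' k : ℕ, (1 + ζ ^ 3 * q ^ (k + 1))) * ∏' k : ℕ, (1 + (ζ ^ 3)⁻¹ * q ^ (k + 1))) =
      ∏' k : ℕ, (1 + 1 * (q ^ 4) ^ (k + 1)) := by
  have hM := fun z => multipliable_one_add_mul_pow z hq
  rw [← (hM _).tprod_mul (hM _), ← (hM _).tprod_mul (hM _),
    ← ((hM _).mul (hM _)).tprod_mul ((hM _).mul (hM _))]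
  refine tprod_congr fun k => ?_
  -- The factors are 1 ± ζx and 1 ± ζ³x, with product 1 - ζ⁴x⁴ = 1 + x⁴.
  have h1 : ζ⁻¹ = -ζ ^ 3 := inv_eq_of_mul_eq_one_right (by linear_combination -hζ)
  have h3 : (ζ ^ 3)⁻¹ = -ζ := inv_eq_of_mul_eq_one_right (by linear_combination -hζ)
  rw [h1, h3, ← pow_mul, mul_comm 4, pow_mul]
  generalize q ^ (k + 1) = x
  linear_combination (-x ^ 2 * ζ ^ 2 + x ^ 4 * (ζ ^ 4 - 1)) * hζ

theorem tprod_one_sub_odd_pow_mul_qProd {q : ℂ} (hq : ‖q‖ < 1) :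
    (∏' k : ℕ, (1 - q ^ (2 * k + 1))) * qProd (q ^ 2) = qProd q := by
  have hinj := mul_right_injective₀ (two_ne_zero' ℕ)
  have hs : Summable fun k : ℕ => ‖-q ^ (k + 1)‖ := by
    simpa using summable_norm_mul_pow_succ 1 hq
  have h1 : Multipliable fun k : ℕ => 1 - q ^ (2 * k + 1) := by
    simpa [sub_eq_add_neg] using! multipliable_one_add_of_summable (hs.comp_injective hinj)
  have h2 : Multipliable fun k : ℕ => 1 - q ^ (2 * k + 1 + 1) := by
    simpa [sub_eq_add_neg] using! multipliable_one_add_of_summable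
      (hs.comp_injective ((add_left_injective 1).comp hinj))
  rw [qProd, qProd, ← tprod_even_mul_odd (f := fun n => 1 - q ^ (n + 1)) h1 h2]
  congr 1
  exact tprod_congr fun k => by rw [← pow_mul]; congr 2

theorem norm_pow_lt_one {q : ℂ} (hq : ‖q‖ < 1) {n : ℕ} (hn : n ≠ 0) : ‖q ^ n‖ < 1 := by
  rw [norm_pow]; exact pow_lt_one₀ (norm_nonneg q) hq hn

theorem thetaSum_zero_half_eq_tprod (z : ℂ) {τ : ℂ} (hτ : 0 < τ.im) :
    thetaSum 0 (1 / 2) z τ = qVar (τ / 8 + z / 2) *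
      (1 + (qVar z)⁻¹) * qProd (qVar τ) *
      ((∏' k : ℕ, (1 + qVar z * qVar τ ^ (k + 1))) *
        ∏' k : ℕ, (1 + (qVar z)⁻¹ * qVar τ ^ (k + 1))) := by
  have h := thetaSum_eq_tprod (1 / 2) z hτ
  rw [sub_self, zero_mul, add_zero] at h
  rw [h, mul_assoc _ (∏' _, _)]
  congr 4; ring

theorem thetaSum_half_zero {τ : ℂ} (hτ : 0 < τ.im) :
    thetaSum 0 (1 / 2) 0 τ = 2 * qVar (τ / 8) * qProd (qVar τ ^ 2) ^ 2 / qProd (qVar τ) := by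
  have hq := norm_qVar_lt_one hτ
  rw [thetaSum_zero_half_eq_tprod 0 hτ, qVar_zero, inv_one, ← tprod_one_add_mul_qProd hq,
    zero_div, add_zero]
  field_simp [qProd_ne_zero hq]
  ring

theorem thetaSum_zero_zero_half {τ : ℂ} (hτ : 0 < τ.im) :
    thetaSum 0 0 (1 / 2) (2 * τ) = qProd (qVar τ) ^ 2 / qProd (qVar τ ^ 2) := by
  have hq := norm_qVar_lt_one hτ
  have hq2 := qProd_ne_zero (norm_pow_lt_one hq two_ne_zero)
  have hq0 := qVar_ne_zero τ
  have h := thetaSum_eq_tprod 0 (1 / 2) (im_two_mul_pos hτ)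
  have e : qVar (1 / 2 + (0 - 1 / 2) * (2 * τ)) = -(qVar τ)⁻¹ := by
    rw [show (1 / 2 + (0 - 1 / 2) * (2 * τ) : ℂ) = 1 / 2 + -τ by ring, qVar_add, qVar_half,
      qVar_neg]
    ring
  have e2 : qVar (2 * τ) = qVar τ ^ 2 := by exact_mod_cast qVar_nat_mul 2 τ
  have e0 : (1 / 2 * 0 ^ 2 * (2 * τ) + 0 * (1 / 2) : ℂ) = 0 := by ring
  rw [e, e0, qVar_zero, e2] at h
  -- Both products run over odd powers of q; the second lacks 1 - q, which the prefactor supplies.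
  have p1 : ∏' k : ℕ, (1 + -(qVar τ)⁻¹ * (qVar τ ^ 2) ^ (k + 1)) =
      ∏' k : ℕ, (1 - qVar τ ^ (2 * k + 1)) := by
    refine tprod_congr fun k => ?_
    field_simp
    ring
  have hM : Multipliable fun k : ℕ => 1 + -qVar τ * (qVar τ ^ 2) ^ (k + 1) :=
    multipliable_one_add_mul_pow (-qVar τ) (norm_pow_lt_one hq two_ne_zero)
  have p2 : (1 + -qVar τ) * ∏' k : ℕ, (1 + -qVar τ * (qVar τ ^ 2) ^ (k + 1)) =
      ∏' k : ℕ, (1 - qVar τ ^ (2 * k + 1)) := by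
    have h2 : Multipliable fun k : ℕ => 1 - qVar τ ^ (2 * (k + 1) + 1) :=
      hM.congr fun k => by ring
    rw [tprod_eq_zero_mul' (f := fun k => 1 - qVar τ ^ (2 * k + 1)) h2, mul_zero, zero_add, pow_one, ← sub_eq_add_neg]
    congr 1
    exact tprod_congr fun k => by ring
  have e3 : (-(qVar τ)⁻¹)⁻¹ = -qVar τ := by rw [inv_neg, inv_inv]
  rw [p1, e3] at h
  rw [h, eq_div_iff hq2, ← tprod_one_sub_odd_pow_mul_qProd hq]
  linear_combination (∏' k : ℕ, (1 - qVar τ ^ (2 * k + 1))) * qProd (qVar τ ^ 2) ^ 2 * p2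

/-! ### The theta series at z = 1/8 and z = 3/8 -/

theorem qVar_eighth_add_inv : qVar (1 / 8) + (qVar (1 / 8))⁻¹ = (Real.sqrt 2 : ℝ) := by
  have h := Complex.two_cos (Real.pi / 4 : ℂ)
  have h2 : Complex.cos (Real.pi / 4 : ℂ) = (Real.sqrt 2 / 2 : ℝ) := by
    rw [← Real.cos_pi_div_four]; push_cast; rfl
  rw [h2] at h
  rw [← qVar_neg, qVar, qVar,
    show 2 * Real.pi * Complex.I * (1 / 8) = Real.pi / 4 * Complex.I by ring,
    show 2 * Real.pi * Complex.I * -(1 / 8) = -(Real.pi / 4) * Complex.I by ring, ← h]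
  push_cast
  ring

theorem qVar_eighth_sq : qVar (1 / 8) ^ 2 = Complex.I := by
  rw [← qVar_quarter, ← qVar_nat_mul]; norm_num

theorem qVar_three_eighths : qVar (3 / 8) = qVar (1 / 8) ^ 3 := by
  rw [← qVar_nat_mul]; norm_num

theorem qVar_eighth_pow_four : qVar (1 / 8) ^ 4 = -1 := by
  rw [← Complex.I_sq, ← qVar_eighth_sq, ← pow_mul]

theorem thetaSum_eighth_mul {τ : ℂ} (hτ : 0 < τ.im) :
    thetaSum 0 (1 / 2) (1 / 8) τ * thetaSum 0 (1 / 2) (3 / 8) τ =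
      (Real.sqrt 2 : ℝ) * qVar (τ / 4) * qProd (qVar τ) ^ 2 * qProd (qVar τ ^ 8) /
        qProd (qVar τ ^ 4) := by
  have hq := norm_qVar_lt_one hτ
  have hq4 := norm_pow_lt_one hq four_ne_zero
  have hE := tprod_primitive_eighth_roots qVar_eighth_pow_four hq
  have hE' := tprod_one_add_mul_qProd hq4
  rw [← hE, ← pow_mul] at hE'
  have hz0 := qVar_ne_zero (1 / 8)
  -- With ζ = `qVar (1 / 8)`, the constant is ζ²(1 + ζ⁻¹)(1 + ζ⁻³) = ζ + ζ⁻¹ = √2, because ζ⁻⁴ = -1.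
  have hc : qVar (τ / 8 + 1 / 8 / 2) * qVar (τ / 8 + 3 / 8 / 2) *
      ((1 + (qVar (1 / 8))⁻¹) * (1 + (qVar (1 / 8) ^ 3)⁻¹)) =
      (Real.sqrt 2 : ℝ) * qVar (τ / 4) := by
    rw [← qVar_add, show τ / 8 + 1 / 8 / 2 + (τ / 8 + 3 / 8 / 2) = τ / 4 + 1 / 4 by ring,
      qVar_add, qVar_quarter, ← qVar_eighth_sq, ← qVar_eighth_add_inv]
    field_simp
    linear_combination qVar (τ / 4) * qVar_eighth_pow_four
  rw [eq_div_iff (qProd_ne_zero hq4), thetaSum_zero_half_eq_tprod _ hτ,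
    thetaSum_zero_half_eq_tprod _ hτ, qVar_three_eighths, ← hc, ← hE']
  ring

theorem thetaSum_three_eighths_ne_zero {τ : ℂ} (hτ : 0 < τ.im) :
    thetaSum 0 (1 / 2) (3 / 8) τ ≠ 0 := by
  have hq := norm_qVar_lt_one hτ
  have hn : ‖qVar (3 / 8)‖ = 1 := by
    rw [qVar, show 2 * Real.pi * Complex.I * (3 / 8) = ((3 * Real.pi / 4 : ℝ) : ℂ) * Complex.I by
      push_cast; ring, Complex.norm_exp_ofReal_mul_I]
  have h1 : 1 + (qVar (3 / 8))⁻¹ ≠ 0 := by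
    intro h
    have h3 : qVar (3 / 8) = -1 := by
      rw [← inv_inv (qVar (3 / 8)), eq_neg_of_add_eq_zero_right h]; norm_num
    have h4 := qVar_eighth_pow_four
    rw [qVar_three_eighths] at h3
    have h5 : qVar (1 / 8) = 1 := by linear_combination qVar (1 / 8) * h3 - h4
    rw [h5] at h3
    norm_num at h3
  rw [thetaSum_zero_half_eq_tprod _ hτ]
  refine mul_ne_zero (mul_ne_zero (mul_ne_zero (qVar_ne_zero _) h1) (qProd_ne_zero hq))
    (mul_ne_zero (tprod_one_add_mul_pow_ne_zero hn.le hq)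
      (tprod_one_add_mul_pow_ne_zero ?_ hq))
  rw [norm_inv, hn, inv_one]

theorem thetaSum_wronskian_eighth {τ : ℂ} (hτ : 0 < τ.im) :
    thetaSum 2 (1 / 2) (1 / 8) τ * thetaSum 0 (1 / 2) (3 / 8) τ -
      thetaSum 0 (1 / 2) (1 / 8) τ * thetaSum 2 (1 / 2) (3 / 8) τ =
      8 * qVar (τ / 4) ^ 5 * qProd (qVar τ ^ 2) ^ 3 * qProd (qVar τ ^ 8) ^ 3 := by
  have h2 := im_two_mul_pos hτ
  have h8 : 0 < (4 * (2 * τ)).im := by simpa using hτ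
  have e1 : (1 / 8 + 3 / 8 : ℂ) = 1 / 2 := by norm_num
  have e2 : (1 / 8 - 3 / 8 : ℂ) = -(1 / 4) := by norm_num
  have n2 : qVar (2 * τ) = qVar τ ^ 2 := by exact_mod_cast qVar_nat_mul 2 τ
  have n8 : qVar (4 * (2 * τ)) = qVar τ ^ 8 := by
    rw [← qVar_nat_mul]; congr 1; push_cast; ring
  have n4 : qVar (4 * (2 * τ) / 8) = qVar (τ / 4) ^ 4 := by
    rw [← qVar_nat_mul]; congr 1; push_cast; ring
  have n1 : qVar (2 * τ / 8) = qVar (τ / 4) := by congr 1; ring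
  rw [thetaSum_wronskian _ _ _ hτ, e1, e2, sub_self, thetaSum_one_zero_half, thetaSum_zero_neg,
    thetaSum_one_zero_quarter h2, thetaSum_one_half_half h2, thetaSum_one_half_half h8, n1, n2, n4,
    n8]
  linear_combination -8 * qVar (τ / 4) ^ 5 * qProd (qVar τ ^ 2) ^ 3 * qProd (qVar τ ^ 8) ^ 3 *
    Complex.I_sq

/-- The quartic form of the theta series that vanishes with `W ^ 2 - 6 * W + 1`. -/
theorem thetaSum_quartic {τ : ℂ} (hτ : 0 < τ.im) :
    (thetaSum 0 (1 / 2) (1 / 8) τ ^ 4 -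
      6 * (thetaSum 0 (1 / 2) (1 / 8) τ * thetaSum 0 (1 / 2) (3 / 8) τ) ^ 2 +
      thetaSum 0 (1 / 2) (3 / 8) τ ^ 4) * thetaSum 0 0 (1 / 2) (2 * τ) ^ 2 =
      8 * (thetaSum 0 (1 / 2) (1 / 8) τ * thetaSum 0 (1 / 2) (3 / 8) τ) ^ 2 *
        thetaSum 0 (1 / 2) 0 (4 * τ) ^ 2 := by
  have h2 := im_two_mul_pos hτ
  have q1 (σ : ℂ) : thetaSum 0 (1 / 2) (3 / 4) σ = -thetaSum 0 (1 / 2) (1 / 4) σ := by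
    have h := thetaSum_add_one 0 (1 / 2) (-(1 / 4)) σ
    rwa [thetaSum_half_neg, qVar_half, show -(1 / 4 : ℂ) + 1 = 3 / 4 by norm_num, pow_zero, one_mul,
      neg_one_mul] at h
  have q2 (σ : ℂ) : thetaSum 0 0 (3 / 4) σ = thetaSum 0 0 (1 / 4) σ := by
    have h := thetaSum_add_one 0 0 (-(1 / 4)) σ
    rwa [thetaSum_zero_neg, qVar_zero, show -(1 / 4 : ℂ) + 1 = 3 / 4 by norm_num, pow_zero, one_mul,
      one_mul] at h
  have q3 (σ : ℂ) : thetaSum 0 0 1 σ = thetaSum 0 0 0 σ := by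
    have h := thetaSum_add_one 0 0 0 σ
    rwa [qVar_zero, zero_add, one_mul] at h
  have q4 (σ : ℂ) : thetaSum 0 (1 / 2) 1 σ = -thetaSum 0 (1 / 2) 0 σ := by
    have h := thetaSum_add_one 0 (1 / 2) 0 σ
    rwa [qVar_half, zero_add, neg_one_mul] at h
  have q5 (z σ : ℂ) : thetaSum 0 (0 - 1 / 2) z σ = thetaSum 0 (1 / 2) z σ := by
    rw [← thetaSum_add_one_char]; norm_num
  have d1 := thetaSum_mul_duplication (1 / 2) (1 / 8) (1 / 8) hτ
  have d2 := thetaSum_mul_duplication (1 / 2) (3 / 8) (3 / 8) hτ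
  have d3 := thetaSum_mul_duplication (1 / 2) (1 / 8) (3 / 8) hτ
  have d4 := thetaSum_mul_duplication 0 0 0 h2
  have d5 := thetaSum_mul_duplication 0 (1 / 2) (1 / 2) h2
  have e1 : (1 / 8 + 1 / 8 : ℂ) = 1 / 4 := by norm_num
  have e2 : (3 / 8 + 3 / 8 : ℂ) = 3 / 4 := by norm_num
  have e3 : (1 / 8 + 3 / 8 : ℂ) = 1 / 2 := by norm_num
  have e4 : (1 / 8 - 3 / 8 : ℂ) = -(1 / 4) := by norm_num
  have e5 : (1 / 2 + 1 / 2 : ℂ) = 1 := by norm_num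
  have e6 : 2 * (2 * τ) = 4 * τ := by ring
  rw [sub_self, sub_self, e1] at d1
  rw [sub_self, sub_self, e2, q1, q2] at d2
  rw [sub_self, e3, e4, thetaSum_zero_half_half, zero_mul, zero_add, thetaSum_half_neg, pow_zero,
    one_mul] at d3
  rw [sub_self, add_zero, q5, e6] at d4
  rw [sub_self, e5, q3, q5, q4, e6] at d5
  have hd : thetaSum 0 (1 / 2) (1 / 8) τ ^ 2 - thetaSum 0 (1 / 2) (3 / 8) τ ^ 2 =
      2 * (thetaSum 0 (1 / 2) (1 / 4) (2 * τ) * thetaSum 0 0 0 (2 * τ)) := by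
    linear_combination d1 - d2
  have hv : thetaSum 0 0 0 (2 * τ) ^ 2 - thetaSum 0 0 (1 / 2) (2 * τ) ^ 2 =
      2 * thetaSum 0 (1 / 2) 0 (4 * τ) ^ 2 := by
    linear_combination d4 - d5
  -- Both A² - B² and AB contain u = θ[1/2](1/4) at 2τ, so `hv` applies to the difference of
  -- squares. The extra factor θ[0](1/2)² in the statement turns u² back into (AB)².
  have hq : thetaSum 0 (1 / 2) (1 / 8) τ ^ 4 -
      6 * (thetaSum 0 (1 / 2) (1 / 8) τ * thetaSum 0 (1 / 2) (3 / 8) τ) ^ 2 +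
      thetaSum 0 (1 / 2) (3 / 8) τ ^ 4 =
      (thetaSum 0 (1 / 2) (1 / 8) τ ^ 2 - thetaSum 0 (1 / 2) (3 / 8) τ ^ 2) ^ 2 -
      4 * (thetaSum 0 (1 / 2) (1 / 8) τ * thetaSum 0 (1 / 2) (3 / 8) τ) ^ 2 := by ring
  rw [hq, hd, d3]
  linear_combination 4 * thetaSum 0 (1 / 2) (1 / 4) (2 * τ) ^ 2 *
    thetaSum 0 0 (1 / 2) (2 * τ) ^ 2 * hv

/-! ### The quotient W and its Riccati equation -/

theorem thetaQuotW_eq (τ : ℂ) : thetaQuotW τ =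
    thetaSum 0 (1 / 2) (1 / 8) τ ^ 2 / thetaSum 0 (1 / 2) (3 / 8) τ ^ 2 := by
  rw [thetaQuotW, thetaChar_eq_thetaSum, thetaChar_eq_thetaSum]
  norm_num

theorem thetaQuotW_periodic : Function.Periodic thetaQuotW (1 : ℝ) := by
  intro τ
  rw [thetaQuotW_eq, thetaQuotW_eq, Complex.ofReal_one, thetaSum_half_add_one_period,
    thetaSum_half_add_one_period, mul_pow, mul_pow,
    mul_div_mul_left _ _ (pow_ne_zero 2 (qVar_ne_zero _))]

theorem hasDerivAt_thetaQuotW {τ : ℂ} (hτ : 0 < τ.im) :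
    HasDerivAt thetaQuotW (2 * Real.pi * Complex.I *
      (thetaSum 0 (1 / 2) (1 / 8) τ *
        (thetaSum 2 (1 / 2) (1 / 8) τ * thetaSum 0 (1 / 2) (3 / 8) τ -
          thetaSum 0 (1 / 2) (1 / 8) τ * thetaSum 2 (1 / 2) (3 / 8) τ) /
        thetaSum 0 (1 / 2) (3 / 8) τ ^ 3)) τ := by
  have hB := thetaSum_three_eighths_ne_zero hτ
  have h := ((hasDerivAt_thetaSum (1 / 2) (1 / 8) hτ).pow 2).div
    ((hasDerivAt_thetaSum (1 / 2) (3 / 8) hτ).pow 2) (pow_ne_zero 2 hB)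
  have hf : thetaQuotW = thetaSum 0 (1 / 2) (1 / 8) ^ 2 / thetaSum 0 (1 / 2) (3 / 8) ^ 2 :=
    funext thetaQuotW_eq
  rw [hf]
  refine h.congr_deriv ?_
  simp only [Pi.pow_apply]
  field_simp
  push_cast
  ring

/-- The Riccati equation in terms of theta series. -/
theorem thetaSum_riccati {τ : ℂ} (hτ : 0 < τ.im) :
    thetaSum 0 (1 / 2) (1 / 8) τ *
        (thetaSum 2 (1 / 2) (1 / 8) τ * thetaSum 0 (1 / 2) (3 / 8) τ -
          thetaSum 0 (1 / 2) (1 / 8) τ * thetaSum 2 (1 / 2) (3 / 8) τ) /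
        thetaSum 0 (1 / 2) (3 / 8) τ ^ 3 =
      1 / ((Real.sqrt 2 : ℝ) : ℂ) ^ 5 *
        (qProd (qVar τ) ^ 2 * qProd (qVar τ ^ 2) * qProd (qVar τ ^ 4) ^ 3 /
          qProd (qVar τ ^ 8) ^ 2) *
        (thetaQuotW τ ^ 2 - 6 * thetaQuotW τ + 1) := by
  have hq := norm_qVar_lt_one hτ
  have h4 : 0 < (4 * τ).im := by simpa using hτ
  have hP1 := qProd_ne_zero hq
  have hP2 := qProd_ne_zero (norm_pow_lt_one hq two_ne_zero)
  have hP4 := qProd_ne_zero (norm_pow_lt_one hq four_ne_zero)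
  have hP8 := qProd_ne_zero (norm_pow_lt_one hq (n := 8) (by norm_num))
  have hB := thetaSum_three_eighths_ne_zero hτ
  have hQ := thetaSum_quartic hτ
  have n4 : qVar (4 * τ) = qVar τ ^ 4 := by exact_mod_cast qVar_nat_mul 4 τ
  have n8 : qVar (4 * τ / 8) = qVar (τ / 4) ^ 2 := by
    rw [← qVar_nat_mul]; congr 1; push_cast; ring
  have hAB := thetaSum_eighth_mul hτ
  rw [thetaSum_zero_zero_half hτ, thetaSum_half_zero h4, n4, n8, ← pow_mul, hAB] at hQ
  rw [thetaSum_wronskian_eighth hτ, thetaQuotW_eq]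
  have hs : ((Real.sqrt 2 : ℝ) : ℂ) ^ 2 = 2 := by
    rw [← Complex.ofReal_pow, Real.sq_sqrt (by norm_num)]; norm_num
  have hs0 : ((Real.sqrt 2 : ℝ) : ℂ) ≠ 0 := by
    intro h; rw [h] at hs; norm_num at hs
  generalize thetaSum 0 (1 / 2) (1 / 8) τ = a, thetaSum 0 (1 / 2) (3 / 8) τ = b,
    qProd (qVar τ) = p₁, qProd (qVar τ ^ 2) = p₂, qProd (qVar τ ^ 4) = p₄,
    qProd (qVar τ ^ 8) = p₈, qVar (τ / 4) = r, ((Real.sqrt 2 : ℝ) : ℂ) = s at *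
  have hQ' : a ^ 4 - 6 * (a * b) ^ 2 + b ^ 4 = 64 * r ^ 6 * p₂ ^ 2 * p₈ ^ 6 / p₄ ^ 4 := by
    have hc : (p₁ ^ 2 / p₂) ^ 2 ≠ 0 := pow_ne_zero 2 (div_ne_zero (pow_ne_zero 2 hP1) hP2)
    refine mul_right_cancel₀ hc ?_
    rw [hAB, hQ]
    field_simp
    linear_combination 32 * r ^ 6 * hs
  -- Over the common denominator b⁴ only the product ab remains, and its value is known. The
  -- constants then agree because s⁶ = 8.
  have h1 : a * (8 * r ^ 5 * p₂ ^ 3 * p₈ ^ 3) / b ^ 3 =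
      (a * b) * (8 * r ^ 5 * p₂ ^ 3 * p₈ ^ 3) / b ^ 4 := by
    field_simp
  have h2 : (a ^ 2 / b ^ 2) ^ 2 - 6 * (a ^ 2 / b ^ 2) + 1 =
      (a ^ 4 - 6 * (a * b) ^ 2 + b ^ 4) / b ^ 4 := by
    field_simp
  have hs6 : s ^ 6 = 8 := by linear_combination (s ^ 4 + 2 * s ^ 2 + 4) * hs
  rw [h1, h2, hQ', hAB]
  field_simp
  linear_combination 8 * r ^ 6 * hs6

/-- The denominator of `W` has no zero in the upper half plane, `W` is a function `w` of
`q = exp (2πiτ)`, and `w` is differentiable there and satisfies the Riccati equation in `q`. -/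
theorem mainTheorem3 :
    (∀ τ : UpperHalfPlane, thetaChar 1 (3 / 4) 0 τ ≠ 0) ∧
    ∃ w : ℂ → ℂ,
      (∀ τ : UpperHalfPlane, w (qVar τ) = thetaQuotW τ) ∧
      ∀ τ : UpperHalfPlane,
        DifferentiableAt ℂ w (qVar τ) ∧
        qVar τ * deriv w (qVar τ) =
          1 / ((Real.sqrt 2 : ℝ) : ℂ) ^ 5 *
            (qProd (qVar τ) ^ 2 * qProd (qVar τ ^ 2) * qProd (qVar τ ^ 4) ^ 3 /
              qProd (qVar τ ^ 8) ^ 2) *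
            (thetaQuotW τ ^ 2 - 6 * thetaQuotW τ + 1) := by
  -- Being 1-periodic, W descends to a function of q, namely its `cuspFunction`.
  have hw : ∀ τ : ℂ, Function.Periodic.cuspFunction 1 thetaQuotW (qVar τ) = thetaQuotW τ := by
    intro τ
    have h := Function.Periodic.eq_cuspFunction one_ne_zero thetaQuotW_periodic τ
    rwa [Function.Periodic.qParam, Complex.ofReal_one, div_one] at h
  refine ⟨fun τ => ?_, Function.Periodic.cuspFunction 1 thetaQuotW, fun τ => hw τ, fun τ => ?_⟩
  · rw [thetaChar_eq_thetaSum]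
    have h := thetaSum_three_eighths_ne_zero τ.im_pos
    norm_num at h ⊢
    exact h
  · have hW := hasDerivAt_thetaQuotW τ.im_pos
    have hd : DifferentiableAt ℂ (Function.Periodic.cuspFunction 1 thetaQuotW) (qVar τ) := by
      have h := Function.Periodic.differentiableAt_cuspFunction one_ne_zero thetaQuotW_periodic
        hW.differentiableAt
      rwa [Function.Periodic.qParam, Complex.ofReal_one, div_one] at h
    refine ⟨hd, ?_⟩
    have hq : HasDerivAt qVar (qVar τ * (2 * Real.pi * Complex.I * 1)) τ :=
      ((hasDerivAt_id (τ : ℂ)).const_mul (2 * Real.pi * Complex.I)).cexp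
    -- By the chain rule dW/dτ = 2πi q dw/dq; the factor 2πi cancels at the end.
    have hc := hd.hasDerivAt.comp (τ : ℂ) hq
    rw [show Function.Periodic.cuspFunction 1 thetaQuotW ∘ qVar = thetaQuotW from funext hw] at hc
    have h := hc.unique hW
    rw [thetaSum_riccati τ.im_pos] at h
    refine mul_left_cancel₀ Complex.two_pi_I_ne_zero ?_
    rw [← h]
    ring
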